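/- Let $n\ge 0$, let $0\le r_1\le r_2\le\dots\le r_n$ be integers, and let $F=\prod_{i=1}^n\{0,1,\dots,r_i-1\}$. For $x\in F$ put $|x|=\sum_{i=1}^n x_i$, and for $T\subseteq F$ and an integer $d\ge 0$ put $T_{\le d}=\{x\in T:|x|\le d\}$. A set $T\subseteq F$ is down-closed if $b\in T$, $a\in F$ and $a_i\le b_i$ for all $i$ imply $a\in T$. In the lexicographic order on $F$, $x$ precedes $y$ if $x_i<y_i$, where $i$ is the smallest index with $x_i\ne y_i$. For $0\le k\le |F|$ let $\mathrm{M}(k)$ be the set of the $k$ lexicographically first elements of $F$, and let $$\mathcal{H}_F(d,k)=\min\{\,|T_{\le d}| : T\subseteq F\text{ down-closed},\ |T|=k\,\}.$$ Then for all integers $d\ge 0$ and $0\le k\le |F|$, $$\mathcal{H}_F(d,k)=|\mathrm{M}(k)_{\le d}|.$$ Moreover, the minimum is attained at $\mathrm{M}(k)$: this set is down-closed, has exactly $k$ elements, and satisfies $|\mathrm{M}(k)_{\le d}|\le |T_{\le d}|$ for every down-closed $T\subseteq F$ with $|T|=k$. -/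

import Mathlib

/-- The grid `F = ∏ i, {0, …, r i - 1}`. Its order `≤` is the coordinatewise order. -/
abbrev Grid {n : ℕ} (r : Fin n → ℕ) : Type := ∀ i : Fin n, Fin (r i)

namespace Grid

/-- The generalized Hamming weight `|x| = ∑ i, x i`, a sum of natural numbers. -/
def weight {n : ℕ} {r : Fin n → ℕ} (x : Grid r) : ℕ := ∑ i, (x i : ℕ)

/-- The set `T_{≤ d}` of the elements of `T` of weight at most `d`. -/
def lowWeight {n : ℕ} {r : Fin n → ℕ} (d : ℕ) (T : Finset (Grid r)) : Finset (Grid r) :=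
  T.filter (fun x => x.weight ≤ d)

/-- The minimum `H_F(d, k)` of `|T_{≤ d}|` over all down-closed `T ⊆ F` with `|T| = k`. -/
noncomputable def minLow {n : ℕ} (r : Fin n → ℕ) (d k : ℕ) : ℕ :=
  sInf {m : ℕ | ∃ T : Finset (Grid r),
    IsLowerSet (T : Set (Grid r)) ∧ T.card = k ∧ (lowWeight d T).card = m}

/-- The lexicographic order on the grid: `x` precedes `y` if `x i < y i`
at the smallest index `i` where they differ. -/
def LexLT {n : ℕ} {r : Fin n → ℕ} (x y : Grid r) : Prop :=
  ∃ i : Fin n, (∀ j : Fin n, j < i → x j = y j) ∧ x i < y i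

open scoped Classical in
/-- The set `M(k)` of the `k` lexicographically first elements of the grid:
those with fewer than `k` predecessors. -/
noncomputable def lexFirst {n : ℕ} (r : Fin n → ℕ) (k : ℕ) : Finset (Grid r) :=
  Finset.univ.filter (fun x : Grid r =>
    (Finset.univ.filter (fun y : Grid r => LexLT y x)).card < k)

end Grid

/-! The proof is by induction on the number of coordinates. In dimension at most one, every
down-closed set is lexicographically initial.

In dimension two, sets are compared diagonal by diagonal. The diagonals of a down-closed set cannot
grow too fast, and beyond the longer side they shrink strictly (`min_le_diagonal_card`,
`diagonal_card_lt`). So either all diagonals up to `d` have at least as many points in the given set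
as in the initial one, or all diagonals above `d` have at most as many; equal sizes turn the second
case into the first inequality.

In dimension at least three, take a competitor with least sum of ranks. By induction, compressing
its slices does no harm, so they are all initial. If the set itself were not, its last element would
weigh no more than the first missing point (`weight_le_of_lex_gap`), and exchanging the two would
lower the sum of ranks.

Monotonicity of `r` matters only in dimension two, and deleting a coordinate preserves it. -/

/-! ### Diagonals of planar down-closed sets -/

/-- The abscissas of the points of `S` on the diagonal `a + b = e`. -/
def diagonal (S : Finset (ℕ × ℕ)) (e : ℕ) : Finset ℕ :=
  (Finset.range (e + 1)).filter (fun a => (a, e - a) ∈ S)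

theorem mem_diagonal {S : Finset (ℕ × ℕ)} {e a : ℕ} :
    a ∈ diagonal S e ↔ a ≤ e ∧ (a, e - a) ∈ S := by
  simp [diagonal]

theorem card_filter_add_eq (S : Finset (ℕ × ℕ)) (e : ℕ) :
    (S.filter (fun p => p.1 + p.2 = e)).card = (diagonal S e).card := by
  refine Finset.card_bij (fun p _ => p.1) ?_ ?_ ?_
  · rintro ⟨a, b⟩ h
    simp only [Finset.mem_filter] at h
    rw [mem_diagonal]
    refine ⟨by omega, ?_⟩
    have : e - a = b := by omega
    rw [this]; exact h.1
  · rintro ⟨a, b⟩ h ⟨a', b'⟩ h' hab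
    simp only [Finset.mem_filter] at h h' hab
    ext <;> simp <;> omega
  · intro a ha
    rw [mem_diagonal] at ha
    exact ⟨(a, e - a), by simp only [Finset.mem_filter]; exact ⟨ha.2, by omega⟩, rfl⟩

theorem card_filter_add_le (S : Finset (ℕ × ℕ)) (d : ℕ) :
    (S.filter (fun p => p.1 + p.2 ≤ d)).card =
      ∑ e ∈ Finset.range (d + 1), (diagonal S e).card := by
  rw [Finset.card_eq_sum_card_fiberwise (f := fun p : ℕ × ℕ => p.1 + p.2)
    (t := Finset.range (d + 1))]
  · refine Finset.sum_congr rfl fun e he => ?_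
    rw [← card_filter_add_eq, Finset.filter_filter]
    congr 1
    ext p
    simp only [Finset.mem_filter, Finset.mem_range] at he ⊢
    constructor
    · rintro ⟨h, _, h'⟩; exact ⟨h, h'⟩
    · rintro ⟨h, h'⟩; exact ⟨h, by omega, h'⟩
  · intro p hp
    simp only [Finset.coe_filter, Set.mem_ofPred_eq] at hp
    simp only [Finset.coe_range, Set.mem_Iio]
    omega

theorem diagonal_card_le (S : Finset (ℕ × ℕ)) (e : ℕ) : (diagonal S e).card ≤ e + 1 :=
  (Finset.card_filter_le _ _).trans_eq (Finset.card_range _)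

/-- Passing to a lower diagonal of a down-closed planar set loses no points,
unless the upper diagonal is full. -/
theorem min_le_diagonal_card {S : Finset (ℕ × ℕ)} (hS : IsLowerSet (S : Set (ℕ × ℕ))) (e : ℕ) :
    min (diagonal S (e + 1)).card (e + 1) ≤ (diagonal S e).card := by
  by_cases hp : ∃ p ≤ e + 1, p ∉ diagonal S (e + 1)
  · obtain ⟨p, hpe, hp⟩ := hp
    refine (min_le_left _ _).trans ?_
    -- Points before the gap `p` move down, points after it move left; the gap keeps the two
    -- families from colliding.
    refine Finset.card_le_card_of_injOn (fun a => if a < p then a else a - 1) ?_ ?_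
    · intro a ha
      have hap : a ≠ p := fun h => hp (h ▸ ha)
      have ha' := mem_diagonal.1 ha
      refine Finset.mem_coe.2 (mem_diagonal.2 ?_)
      by_cases h : a < p
      · simp only [h, if_true]
        refine ⟨by omega, hS (a := (a, e + 1 - a)) ?_ ha'.2⟩
        exact ⟨le_rfl, by simp; omega⟩
      · simp only [h, if_false]
        refine ⟨by omega, hS (a := (a, e + 1 - a)) ?_ ha'.2⟩
        exact ⟨by simp, by simp; omega⟩
    · intro a ha b hb hab
      have hap : a ≠ p := fun h => hp (h ▸ ha)
      have hbp : b ≠ p := fun h => hp (h ▸ hb)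
      simp only at hab
      split_ifs at hab <;> omega
  · push Not at hp
    refine (min_le_right _ _).trans ?_
    have : Finset.range (e + 1) ⊆ diagonal S e := by
      intro a ha
      have ha := Finset.mem_range.1 ha
      have h := (mem_diagonal.1 (hp a (by omega))).2
      refine mem_diagonal.2 ⟨by omega, hS (a := (a, e + 1 - a)) ?_ h⟩
      exact ⟨le_rfl, by simp; omega⟩
    simpa using Finset.card_le_card this

/-- Beyond the longer side of the box the diagonals get strictly shorter. -/
theorem diagonal_card_lt {S : Finset (ℕ × ℕ)} (hS : IsLowerSet (S : Set (ℕ × ℕ))) {N e : ℕ}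
    (hN : ∀ p ∈ S, p.1 < N ∧ p.2 < N) (he : N ≤ e + 1) (h0 : 0 < (diagonal S (e + 1)).card) :
    (diagonal S (e + 1)).card < (diagonal S e).card := by
  set U := diagonal S (e + 1) with hU
  have hne : U.Nonempty := Finset.card_pos.1 h0
  have hpos : ∀ a ∈ U, 0 < a := by
    intro a ha
    have := mem_diagonal.1 ha
    have := hN _ this.2
    simp only at this
    omega
  have hlt : ∀ a ∈ U, a ≤ e := by
    intro a ha
    have := mem_diagonal.1 ha
    have := hN _ this.2
    simp only at this
    omega
  -- Both coordinates are positive on this diagonal, so all points can move left; moving the last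
  -- one down instead gives one extra point.
  have hnot : U.max' hne ∉ U.image (fun a => a - 1) := by
    intro h
    obtain ⟨a, ha, hae⟩ := Finset.mem_image.1 h
    have := U.le_max' a ha
    have := hpos a ha
    omega
  have hinj : (U.image (fun a => a - 1)).card = U.card := by
    refine Finset.card_image_of_injOn ?_
    intro a ha b hb hab
    have := hpos a ha
    have := hpos b hb
    simp only at hab
    omega
  rw [← hinj, ← Nat.succ_le_iff, ← Nat.add_one, ← Finset.card_insert_of_notMem hnot]
  refine Finset.card_le_card ?_
  intro b hb
  rcases Finset.mem_insert.1 hb with rfl | hb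
  · have hm := U.max'_mem hne
    refine mem_diagonal.2 ⟨hlt _ hm, hS (a := (U.max' hne, e + 1 - U.max' hne)) ?_
      (mem_diagonal.1 hm).2⟩
    exact ⟨le_rfl, by simp; omega⟩
  · obtain ⟨a, ha, rfl⟩ := Finset.mem_image.1 hb
    have := hpos a ha
    have := hlt a ha
    refine mem_diagonal.2 ⟨by omega, hS (a := (a, e + 1 - a)) ?_ (mem_diagonal.1 ha).2⟩
    exact ⟨by simp, by simp; omega⟩

/-- Among down-closed planar sets in a box, those made of full rows and one partial row
have the fewest points below any diagonal. -/
theorem card_filter_add_le_of_isLowerSet {S M : Finset (ℕ × ℕ)} {m N q : ℕ}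
    (hmN : m ≤ N) (hqm : q < m)
    (hS : IsLowerSet (S : Set (ℕ × ℕ))) (hbox : ∀ p ∈ S, p.1 < m ∧ p.2 < N)
    (hMbox : ∀ p ∈ M, p.1 ≤ q ∧ p.2 < N) (hM : ∀ p : ℕ × ℕ, p.1 < q → p.2 < N → p ∈ M)
    (hcard : S.card = M.card) (d : ℕ) :
    (M.filter (fun p => p.1 + p.2 ≤ d)).card ≤ (S.filter (fun p => p.1 + p.2 ≤ d)).card := by
  have hMle : ∀ e, (diagonal M e).card ≤ min (q + 1) (e + 1) - (e + 1 - N) := by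
    intro e
    have : diagonal M e ⊆ Finset.Ico (e + 1 - N) (min (q + 1) (e + 1)) := by
      intro a ha
      have ha := mem_diagonal.1 ha
      have := hMbox _ ha.2
      simp only at this
      rw [Finset.mem_Ico]; omega
    simpa using Finset.card_le_card this
  have hMge : ∀ e, min q (e + 1) - (e + 1 - N) ≤ (diagonal M e).card := by
    intro e
    have : Finset.Ico (e + 1 - N) (min q (e + 1)) ⊆ diagonal M e := by
      intro a ha
      rw [Finset.mem_Ico] at ha
      exact mem_diagonal.2 ⟨by omega, hM _ (by simp; omega) (by simp; omega)⟩
    simpa using Finset.card_le_card this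
  have hi := min_le_diagonal_card hS
  have hii : ∀ e, N ≤ e + 1 → 0 < (diagonal S (e + 1)).card →
      (diagonal S (e + 1)).card < (diagonal S e).card := fun e =>
    diagonal_card_lt hS fun p hp => ⟨(hbox p hp).1.trans_le hmN, (hbox p hp).2⟩
  have hlow : (∀ e ≤ d, min (q + 1) (e + 1) - (e + 1 - N) ≤ (diagonal S e).card) →
      (M.filter (fun p => p.1 + p.2 ≤ d)).card ≤ (S.filter (fun p => p.1 + p.2 ≤ d)).card := by
    intro h
    rw [card_filter_add_le, card_filter_add_le]
    refine Finset.sum_le_sum fun e he => (hMle e).trans (h e ?_)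
    have := Finset.mem_range.1 he
    omega
  by_cases hfull : (diagonal S (d + 1)).card = d + 2
  · refine hlow fun e he => ?_
    have key : ∀ j e, e + j = d + 1 → (diagonal S e).card = e + 1 := by
      intro j
      induction j with
      | zero => intro e he; obtain rfl : e = d + 1 := by omega
                exact hfull
      | succ j ih =>
        intro e he
        have h1 := ih (e + 1) (by omega)
        have h2 := hi e
        have h3 := diagonal_card_le S e
        omega
    have := key (d + 1 - e) e (by omega)
    omega
  -- The bounds `hMge` and `hMle` differ by at most one. Hence `S` on diagonal `d + 1` either
  -- reaches the upper one, which propagates to lower diagonals, or is within the lower one, which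
  -- propagates to higher diagonals.
  by_cases hc : min q (d + 2) - (d + 2 - N) < (diagonal S (d + 1)).card
  · refine hlow fun e he => ?_
    have key : ∀ j e, e + j = d + 1 → 0 < (diagonal S e).card ∧
        (min (q + 1) (e + 1) - (e + 1 - N) ≤ (diagonal S e).card) := by
      intro j
      induction j with
      | zero =>
        intro e he; obtain rfl : e = d + 1 := by omega
        omega
      | succ j ih =>
        intro e he
        have h1 := ih (e + 1) (by omega)
        have h2 := hi e
        have h3 := hii e
        omega
    exact (key (d + 1 - e) e (by omega)).2
  · have key : ∀ j, (diagonal S (d + 1 + j)).card < d + 1 + j + 1 ∧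
        (diagonal S (d + 1 + j)).card ≤ min q (d + 1 + j + 1) - (d + 1 + j + 1 - N) := by
      intro j
      induction j with
      | zero =>
        have := diagonal_card_le S (d + 1)
        simp only [add_zero]
        omega
      | succ j ih =>
        have h2 := hi (d + 1 + j)
        have h3 := hii (d + 1 + j)
        rw [← add_assoc (d + 1) j 1]
        omega
    -- No point of the box has coordinate sum above `m + N`, so these diagonals exhaust the rest of
    -- `A`.
    have hbig : ∀ A : Finset (ℕ × ℕ), (∀ p ∈ A, p.1 ≤ m ∧ p.2 ≤ N) →
        A.card = (A.filter (fun p => p.1 + p.2 ≤ d)).card +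
          ∑ j ∈ Finset.range (m + N), (diagonal A (d + 1 + j)).card := by
      intro A hA
      have : A.filter (fun p => p.1 + p.2 ≤ d + (m + N)) = A := by
        refine Finset.filter_true_of_mem fun p hp => ?_
        have := hA p hp
        omega
      conv_lhs => rw [← this]
      rw [card_filter_add_le, card_filter_add_le, add_right_comm d (m + N) 1,
        Finset.sum_range_add]
    have hS' := hbig S fun p hp => ⟨(hbox p hp).1.le, (hbox p hp).2.le⟩
    have hM' := hbig M fun p hp => ⟨by have := (hMbox p hp).1; omega, (hMbox p hp).2.le⟩
    have : ∑ j ∈ Finset.range (m + N), (diagonal S (d + 1 + j)).card ≤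
        ∑ j ∈ Finset.range (m + N), (diagonal M (d + 1 + j)).card :=
      Finset.sum_le_sum fun j _ => (key j).2.trans (hMge _)
    omega

namespace Grid

/-! ### Lexicographic ranks and initial sets -/

section LexOrder

variable {n : ℕ} {r : Fin n → ℕ}

theorem lexLT_iff {x y : Grid r} : LexLT x y ↔ toLex x < toLex y := Iff.rfl

theorem LexLT.trans {x y z : Grid r} (h : LexLT x y) (h' : LexLT y z) : LexLT x z :=
  lexLT_iff.2 ((lexLT_iff.1 h).trans (lexLT_iff.1 h'))

theorem lexLT_irrefl (x : Grid r) : ¬ LexLT x x := fun h => lt_irrefl _ (lexLT_iff.1 h)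

theorem lexLT_trichotomy (x y : Grid r) : LexLT x y ∨ x = y ∨ LexLT y x := by
  rcases lt_trichotomy (toLex x) (toLex y) with h | h | h
  · exact Or.inl h
  · exact Or.inr (Or.inl (toLex.injective h))
  · exact Or.inr (Or.inr h)

theorem lexLT_of_le_of_ne {x y : Grid r} (h : x ≤ y) (hne : x ≠ y) : LexLT x y :=
  lexLT_iff.2 (lt_of_le_of_ne (Pi.toLex_monotone h) fun e => hne (toLex.injective e))

open scoped Classical in
/-- The number of lexicographic predecessors. -/
noncomputable def rank (x : Grid r) : ℕ :=
  (Finset.univ.filter (fun y : Grid r => LexLT y x)).card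

theorem LexLT.rank_lt {x y : Grid r} (h : LexLT x y) : rank x < rank y := by
  classical
  refine Finset.card_lt_card (Finset.ssubset_iff_of_subset ?_ |>.2 ⟨x, ?_, ?_⟩)
  · intro z hz
    simp only [Finset.mem_filter, Finset.mem_univ, true_and] at hz ⊢
    exact hz.trans h
  · simpa using h
  · simpa using lexLT_irrefl x

theorem lexLT_of_rank_lt {x y : Grid r} (h : rank x < rank y) : LexLT x y := by
  rcases lexLT_trichotomy x y with h' | rfl | h'
  · exact h'
  · exact absurd h (lt_irrefl _)
  · exact absurd h'.rank_lt h.asymm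

theorem rank_injective : Function.Injective (rank : Grid r → ℕ) := by
  intro x y h
  rcases lexLT_trichotomy x y with h' | h' | h'
  · exact absurd h h'.rank_lt.ne
  · exact h'
  · exact absurd h h'.rank_lt.ne'

theorem rank_lt_card (x : Grid r) : rank x < Fintype.card (Grid r) := by
  classical
  refine Finset.card_lt_univ_of_notMem (x := x) ?_
  simpa using lexLT_irrefl x

theorem image_rank_univ :
    Finset.univ.image (rank : Grid r → ℕ) = Finset.range (Fintype.card (Grid r)) := by
  refine Finset.eq_of_subset_of_card_le ?_ ?_
  · intro m hm
    obtain ⟨x, -, rfl⟩ := Finset.mem_image.1 hm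
    exact Finset.mem_range.2 (rank_lt_card x)
  · rw [Finset.card_image_of_injective _ rank_injective, Finset.card_range, Finset.card_univ]

theorem mem_lexFirst {k : ℕ} {x : Grid r} : x ∈ lexFirst r k ↔ rank x < k := by
  simp [lexFirst, rank]

theorem card_lexFirst {k : ℕ} (hk : k ≤ Fintype.card (Grid r)) : (lexFirst r k).card = k := by
  have : (lexFirst r k).image rank = Finset.range k := by
    ext m
    simp only [Finset.mem_image, mem_lexFirst, Finset.mem_range]
    constructor
    · rintro ⟨x, hx, rfl⟩; exact hx
    · intro hm
      have : m ∈ Finset.univ.image (rank : Grid r → ℕ) := by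
        rw [image_rank_univ]; exact Finset.mem_range.2 (hm.trans_le hk)
      obtain ⟨x, -, rfl⟩ := Finset.mem_image.1 this
      exact ⟨x, hm, rfl⟩
  rw [← Finset.card_image_of_injective _ rank_injective, this, Finset.card_range]

/-- A set of grid points closed under lexicographic predecessors. -/
def IsLexInitial (I : Finset (Grid r)) : Prop :=
  ∀ ⦃x y : Grid r⦄, LexLT x y → y ∈ I → x ∈ I

theorem isLexInitial_lexFirst (k : ℕ) : IsLexInitial (lexFirst r k) := by
  intro x y h hy
  rw [mem_lexFirst] at hy ⊢
  exact h.rank_lt.trans hy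

theorem IsLexInitial.isLowerSet {I : Finset (Grid r)} (hI : IsLexInitial I) :
    IsLowerSet (I : Set (Grid r)) := by
  intro y x hxy hy
  rcases eq_or_ne x y with rfl | hne
  · exact hy
  · exact hI (lexLT_of_le_of_ne hxy hne) hy

theorem IsLexInitial.eq_of_card_eq {I J : Finset (Grid r)} (hI : IsLexInitial I)
    (hJ : IsLexInitial J) (h : I.card = J.card) : I = J := by
  by_cases hIJ : I ⊆ J
  · exact Finset.eq_of_subset_of_card_le hIJ h.ge
  · obtain ⟨x, hx, hxJ⟩ := Finset.not_subset.1 hIJ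
    refine (Finset.eq_of_subset_of_card_le (fun y hy => ?_) h.le).symm
    rcases lexLT_trichotomy x y with h' | rfl | h'
    · exact absurd (hJ h' hy) hxJ
    · exact hx
    · exact hI h' hx

theorem IsLexInitial.lexLT {I : Finset (Grid r)} (hI : IsLexInitial I) {x y : Grid r}
    (hx : x ∈ I) (hy : y ∉ I) : LexLT x y := by
  rcases lexLT_trichotomy x y with h | rfl | h
  · exact h
  · exact absurd hx hy
  · exact absurd (hI h hx) hy

/-- The differences `I \ A` and `A \ I` are equinumerous and nonempty, and the maximum of `f` on the
first separates them. -/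
theorem sum_lt_sum_of_card_eq {α : Type*} [DecidableEq α] {I A : Finset α} {f : α → ℕ}
    (hcard : I.card = A.card) (hne : I ≠ A) (h : ∀ x ∈ I, x ∉ A → ∀ y ∈ A, y ∉ I → f x < f y) :
    ∑ x ∈ I, f x < ∑ x ∈ A, f x := by
  have hc : (I \ A).card = (A \ I).card := by
    have h1 := Finset.card_sdiff_add_card_inter I A
    have h2 := Finset.card_sdiff_add_card_inter A I
    rw [Finset.inter_comm] at h2
    omega
  have hI : (I \ A).Nonempty := by
    rw [Finset.sdiff_nonempty]
    exact fun hs => hne (Finset.eq_of_subset_of_card_le hs hcard.ge)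
  rw [← Finset.sum_inter_add_sum_sdiff I A, ← Finset.sum_inter_add_sum_sdiff A I,
    Finset.inter_comm A I]
  refine Nat.add_lt_add_left ?_ _
  obtain ⟨m, hm, hmax⟩ := Finset.exists_max_image (I \ A) f hI
  rw [Finset.mem_sdiff] at hm
  calc ∑ x ∈ I \ A, f x ≤ (I \ A).card • f m := Finset.sum_le_card_nsmul _ _ _ hmax
    _ < (A \ I).card • (f m + 1) := by
        rw [← hc, smul_eq_mul, smul_eq_mul]
        exact Nat.mul_lt_mul_of_pos_left (Nat.lt_succ_self _) hI.card_pos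
    _ ≤ ∑ x ∈ A \ I, f x := by
        refine Finset.card_nsmul_le_sum _ _ _ fun y hy => ?_
        rw [Finset.mem_sdiff] at hy
        exact h m hm.1 hm.2 y hy.1 hy.2

/-- Lexicographically initial sets have the fewest elements of low weight among the down-closed
sets of their size. -/
def LexMinimizes (r : Fin n → ℕ) : Prop :=
  ∀ (d : ℕ) (T I : Finset (Grid r)), IsLowerSet (T : Set (Grid r)) → IsLexInitial I →
    I.card = T.card → (lowWeight d I).card ≤ (lowWeight d T).card

end LexOrder

/-! ### Slices and compression -/

section Slices

variable {n : ℕ} {r : Fin (n + 1) → ℕ}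

/-- The grid point with `i`-th coordinate `a` and the other coordinates given by `y`. -/
def insertAt (i : Fin (n + 1)) (a : Fin (r i)) (y : Grid fun j => r (i.succAbove j)) : Grid r :=
  Fin.insertNth (α := fun j => Fin (r j)) i a y

/-- Deleting the `i`-th coordinate. -/
def removeAt (i : Fin (n + 1)) (x : Grid r) : Grid fun j => r (i.succAbove j) :=
  fun j => x (i.succAbove j)

@[simp] theorem insertAt_same (i : Fin (n + 1)) (a : Fin (r i)) (y) : insertAt i a y i = a := by
  simp [insertAt]

@[simp] theorem insertAt_succAbove (i : Fin (n + 1)) (a : Fin (r i)) (y) (j : Fin n) :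
    insertAt i a y (i.succAbove j) = y j := by
  simp [insertAt]

@[simp] theorem removeAt_insertAt (i : Fin (n + 1)) (a : Fin (r i)) (y) :
    removeAt i (insertAt i a y) = y := by
  funext j; simp [removeAt]

@[simp] theorem insertAt_removeAt (i : Fin (n + 1)) (x : Grid r) :
    insertAt i (x i) (removeAt i x) = x := by
  funext j
  rcases Fin.eq_self_or_eq_succAbove i j with rfl | ⟨j, rfl⟩ <;> simp [removeAt]

theorem LexLT.insertAt {i : Fin (n + 1)} (a : Fin (r i)) {y y' : Grid fun j => r (i.succAbove j)}
    (h : LexLT y y') : LexLT (insertAt i a y) (insertAt i a y') := by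
  obtain ⟨j, hj, hlt⟩ := h
  refine ⟨i.succAbove j, fun l hl => ?_, by simpa using hlt⟩
  rcases Fin.eq_self_or_eq_succAbove i l with rfl | ⟨l, rfl⟩
  · simp
  · simpa using hj l ((Fin.strictMono_succAbove i).lt_iff_lt.1 hl)

theorem weight_insertAt (i : Fin (n + 1)) (a : Fin (r i)) (y) :
    (insertAt i a y).weight = a + y.weight := by
  simp [weight, Fin.sum_univ_succAbove _ i]

/-- The slice of `T` where the `i`-th coordinate is `a`. -/
def slice (T : Finset (Grid r)) (i : Fin (n + 1)) (a : Fin (r i)) :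
    Finset (Grid fun j => r (i.succAbove j)) :=
  Finset.univ.filter (fun y => insertAt i a y ∈ T)

@[simp] theorem mem_slice {T : Finset (Grid r)} {i : Fin (n + 1)} {a : Fin (r i)} {y} :
    y ∈ slice T i a ↔ insertAt i a y ∈ T := by simp [slice]

theorem sum_eq_sum_slice (T : Finset (Grid r)) (i : Fin (n + 1)) (f : Grid r → ℕ) :
    ∑ x ∈ T, f x = ∑ a, ∑ y ∈ slice T i a, f (insertAt i a y) := by
  rw [Finset.sum_sigma' Finset.univ (fun a => slice T i a)
    (fun a y => f (insertAt i a y))]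
  refine Finset.sum_bij' (fun x _ => ⟨x i, removeAt i x⟩) (fun p _ => insertAt i p.1 p.2)
    ?_ ?_ ?_ ?_ ?_
  · intro x hx; simpa using hx
  · intro p hp; simpa using hp
  · intro x _; simp
  · rintro ⟨a, y⟩ _; simp
  · intro x _; simp

theorem card_eq_sum_card_slice (T : Finset (Grid r)) (i : Fin (n + 1)) :
    T.card = ∑ a, (slice T i a).card := by
  simp only [Finset.card_eq_sum_ones]
  exact sum_eq_sum_slice T i _

theorem slice_lowWeight (T : Finset (Grid r)) (i : Fin (n + 1)) (a : Fin (r i)) (d : ℕ) :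
    slice (lowWeight d T) i a = if (a : ℕ) ≤ d then lowWeight (d - a) (slice T i a) else ∅ := by
  ext y
  split_ifs with h
  · simp only [mem_slice, lowWeight, Finset.mem_filter, weight_insertAt]
    refine and_congr_right fun _ => ?_
    omega
  · simp only [mem_slice, lowWeight, Finset.mem_filter, weight_insertAt, Finset.notMem_empty,
      iff_false, not_and]
    omega

theorem isLowerSet_slice {T : Finset (Grid r)} (hT : IsLowerSet (T : Set (Grid r)))
    (i : Fin (n + 1)) (a : Fin (r i)) : IsLowerSet (slice T i a : Set (Grid fun j => r (i.succAbove j))) := by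
  intro y y' h hy
  simp only [Finset.mem_coe, mem_slice] at hy ⊢
  refine hT (fun j => ?_) hy
  rcases Fin.eq_self_or_eq_succAbove i j with rfl | ⟨j, rfl⟩
  · simp
  · simpa using h j

theorem slice_subset_slice {T : Finset (Grid r)} (hT : IsLowerSet (T : Set (Grid r)))
    (i : Fin (n + 1)) {a b : Fin (r i)} (hab : a ≤ b) : slice T i b ⊆ slice T i a := by
  intro y hy
  rw [mem_slice] at hy ⊢
  refine hT (fun j => ?_) hy
  rcases Fin.eq_self_or_eq_succAbove i j with rfl | ⟨j, rfl⟩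
  · simpa using hab
  · simp

/-- Replacing every slice in direction `i` by the lexicographically initial set of its size. -/
noncomputable def compress (T : Finset (Grid r)) (i : Fin (n + 1)) : Finset (Grid r) :=
  Finset.univ.filter (fun x => removeAt i x ∈ lexFirst _ (slice T i (x i)).card)

@[simp] theorem slice_compress (T : Finset (Grid r)) (i : Fin (n + 1)) (a : Fin (r i)) :
    slice (compress T i) i a = lexFirst _ (slice T i a).card := by
  ext y; simp [compress]

theorem card_slice_compress (T : Finset (Grid r)) (i : Fin (n + 1)) (a : Fin (r i)) :
    (slice (compress T i) i a).card = (slice T i a).card := by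
  rw [slice_compress, card_lexFirst (Finset.card_le_univ _)]

theorem card_compress (T : Finset (Grid r)) (i : Fin (n + 1)) :
    (compress T i).card = T.card := by
  simp only [card_eq_sum_card_slice _ i, card_slice_compress]

/-- Slices of a down-closed set shrink as the coordinate grows, so the initial sets replacing them
are nested. -/
theorem isLowerSet_compress {T : Finset (Grid r)} (hT : IsLowerSet (T : Set (Grid r)))
    (i : Fin (n + 1)) : IsLowerSet (compress T i : Set (Grid r)) := by
  intro x x' h hx
  simp only [compress, Finset.coe_filter, Finset.mem_univ, true_and, Set.mem_ofPred_eq] at hx ⊢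
  have h1 : removeAt i x' ∈ lexFirst _ (slice T i (x i)).card :=
    (isLexInitial_lexFirst _).isLowerSet (fun j => h _ : removeAt i x' ≤ removeAt i x) hx
  rw [mem_lexFirst] at h1 ⊢
  exact h1.trans_le (Finset.card_le_card (slice_subset_slice hT i (h i)))

theorem card_lowWeight_compress_le {i : Fin (n + 1)}
    (ih : LexMinimizes fun j => r (i.succAbove j)) {T : Finset (Grid r)}
    (hT : IsLowerSet (T : Set (Grid r))) (d : ℕ) :
    (lowWeight d (compress T i)).card ≤ (lowWeight d T).card := by
  rw [card_eq_sum_card_slice _ i, card_eq_sum_card_slice (lowWeight d T) i]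
  refine Finset.sum_le_sum fun a _ => ?_
  rw [slice_lowWeight, slice_lowWeight]
  split_ifs
  · refine ih _ _ _ (isLowerSet_slice hT i a) ?_ (card_slice_compress T i a)
    rw [slice_compress]
    exact isLexInitial_lexFirst _
  · rfl

/-- Makes the sum of ranks a potential for compression: each slice that changes strictly lowers it,
because inserting a fixed coordinate preserves the order. -/
theorem sum_rank_compress_lt {T : Finset (Grid r)} {i : Fin (n + 1)} {b : Fin (r i)}
    (hb : ¬ IsLexInitial (slice T i b)) :
    ∑ x ∈ compress T i, rank x < ∑ x ∈ T, rank x := by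
  classical
  rw [sum_eq_sum_slice _ i, sum_eq_sum_slice T i]
  have key : ∀ a, slice (compress T i) i a ≠ slice T i a →
      ∑ y ∈ slice (compress T i) i a, rank (insertAt i a y) <
        ∑ y ∈ slice T i a, rank (insertAt i a y) := by
    intro a ha
    refine sum_lt_sum_of_card_eq (card_slice_compress T i a) ha ?_
    intro x hx _ y _ hy
    rw [slice_compress] at hx hy
    exact (((isLexInitial_lexFirst _).lexLT hx hy).insertAt a).rank_lt
  refine Finset.sum_lt_sum (fun a _ => ?_) ⟨b, Finset.mem_univ _, key b fun h => hb ?_⟩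
  · by_cases h : slice (compress T i) i a = slice T i a
    · rw [h]
    · exact (key a h).le
  · rw [← h, slice_compress]
    exact isLexInitial_lexFirst _

theorem mem_of_isLexInitial_slice {T : Finset (Grid r)} {i : Fin (n + 1)}
    (h : ∀ a, IsLexInitial (slice T i a)) {x y : Grid r} (hxy : LexLT x y) (hy : y ∈ T)
    (hi : x i = y i) : x ∈ T := by
  have hx' := insertAt_removeAt i x
  have hy' := insertAt_removeAt i y
  rw [hi] at hx'
  rcases lexLT_trichotomy (removeAt i x) (removeAt i y) with h' | h' | h'
  · have := h (y i) h' (by simpa using hy)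
    rwa [mem_slice, hx'] at this
  · rw [h', hy'] at hx'
    exact hx' ▸ hy
  · have := h'.insertAt (y i)
    rw [hx', hy'] at this
    exact absurd (hxy.trans this) (lexLT_irrefl _)

end Slices

end Grid

namespace Grid

/-! ### The exchange argument in dimension at least three -/

theorem exists_lex_gap {n : ℕ} {r : Fin n → ℕ} {T : Finset (Grid r)} (hT : ¬ IsLexInitial T) :
    ∃ x y : Grid r, x ∉ T ∧ y ∈ T ∧ LexLT x y ∧ (∀ z, LexLT z x → z ∈ T) ∧
      ∀ z ∈ T, ¬ LexLT y z := by
  classical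
  simp only [IsLexInitial, not_forall] at hT
  obtain ⟨x₀, y₀, h, hy₀, hx₀⟩ := hT
  obtain ⟨x, hx, hxmin⟩ := Finset.exists_min_image Tᶜ rank ⟨x₀, by simpa using hx₀⟩
  obtain ⟨y, hy, hymax⟩ := Finset.exists_max_image T rank ⟨y₀, hy₀⟩
  refine ⟨x, y, by simpa using hx, hy, lexLT_of_rank_lt ?_, fun z hz => ?_, fun z hz h' => ?_⟩
  · exact (hxmin x₀ (by simpa using hx₀)).trans_lt (h.rank_lt.trans_le (hymax y₀ hy₀))
  · by_contra hzT
    exact (hxmin z (by simpa using hzT)).not_gt hz.rank_lt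
  · exact (hymax z hz).not_gt h'.rank_lt

theorem weight_le_of_lex_gap {n : ℕ} {r : Fin (n + 3) → ℕ} {T : Finset (Grid r)}
    (hP : ∀ (i : Fin (n + 3)) (x y : Grid r), LexLT x y → y ∈ T → x i = y i → x ∈ T)
    {x y : Grid r} (hx : x ∉ T) (hy : y ∈ T) (hxy : LexLT x y) : y.weight ≤ x.weight := by
  have hne : ∀ i, x i ≠ y i := fun i h => hx (hP i x y hxy hy h)
  have h0 : x 0 < y 0 := by
    obtain ⟨i, hi, hlt⟩ := hxy
    rcases eq_or_ne i 0 with rfl | h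
    · exact hlt
    · exact absurd (hi 0 (Fin.pos_iff_ne_zero.2 h)) (hne 0)
  have hlt : ∀ j : Fin (n + 2), (y j.succ : ℕ) < x j.succ := by
    intro j
    by_contra hcon
    have hj : x j.succ < y j.succ := lt_of_le_of_ne (not_lt.1 hcon) (hne _)
    -- An intermediate point sharing coordinate `j.succ` with `y` and coordinate `0` with `x`:
    -- membership passes from `y` to `z` to `x`.
    set z : Grid r := Function.update x j.succ (y j.succ) with hz
    have hz0 : z 0 = x 0 := Function.update_of_ne (Fin.succ_ne_zero j).symm _ _
    have hzj : z j.succ = y j.succ := Function.update_self _ _ _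
    have hxz : LexLT x z := by
      refine ⟨j.succ, fun l hl => ?_, hzj ▸ hj⟩
      exact (Function.update_of_ne hl.ne _ _).symm
    have hzy : LexLT z y := ⟨0, fun l hl => absurd hl (Fin.not_lt_zero l), hz0 ▸ h0⟩
    exact hx (hP 0 x z hxz (hP j.succ z y hzy hy hzj) hz0.symm)
  have h1 : (y 0 : ℕ) ≤ x 0 + 1 := by
    by_contra hcon
    have hlt' : (x 0 : ℕ) + 1 < y 0 := not_le.1 hcon
    -- Again lexicographically between `x` and `y`, sharing coordinate `2` with `y` and coordinate
    -- `1` with `x`; this is where three coordinates are needed.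
    set z : Grid r := Function.update (Function.update x 0 ⟨x 0 + 1, hlt'.trans (y 0).2⟩) 2 (y 2)
      with hz
    have hmod : 2 % (n + 3) = 2 := Nat.mod_eq_of_lt (by omega)
    have h20 : (0 : Fin (n + 3)) ≠ 2 := by simp [Fin.ext_iff, hmod]
    have h21 : (1 : Fin (n + 3)) ≠ 2 := by simp [Fin.ext_iff, hmod]
    have h10 : (1 : Fin (n + 3)) ≠ 0 := by simp
    have hz0 : z 0 = ⟨x 0 + 1, hlt'.trans (y 0).2⟩ := by
      rw [hz, Function.update_of_ne h20, Function.update_self]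
    have hz1 : z 1 = x 1 := by
      rw [hz, Function.update_of_ne h21, Function.update_of_ne h10]
    have hz2 : z 2 = y 2 := Function.update_self _ _ _
    have hxz : LexLT x z := ⟨0, fun l hl => absurd hl (Fin.not_lt_zero l), by
      rw [hz0, Fin.lt_def]; exact Nat.lt_succ_self _⟩
    have hzy : LexLT z y := ⟨0, fun l hl => absurd hl (Fin.not_lt_zero l), by
      rw [hz0, Fin.lt_def]; exact hlt'⟩
    exact hx (hP 1 x z hxz (hP 2 z y hzy hy hz2) hz1.symm)
  rw [weight, weight, Fin.sum_univ_succ, Fin.sum_univ_succ (fun i => (x i : ℕ))]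
  have : ∑ j : Fin (n + 2), (y j.succ : ℕ) < ∑ j : Fin (n + 2), (x j.succ : ℕ) :=
    Finset.sum_lt_sum_of_nonempty ⟨0, Finset.mem_univ _⟩ fun j _ => hlt j
  omega

/-- Exchanging the lexicographically last element `y` of `T` for the first missing one `x`. -/
theorem exchange_lex_gap {n : ℕ} {r : Fin n → ℕ} [DecidableEq (Grid r)] {T : Finset (Grid r)}
    {x y : Grid r} (hT : IsLowerSet (T : Set (Grid r)))
    (hx : x ∉ T) (hy : y ∈ T) (hxy : LexLT x y) (hxmin : ∀ z, LexLT z x → z ∈ T)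
    (hymax : ∀ z ∈ T, ¬ LexLT y z) (hw : y.weight ≤ x.weight) (d : ℕ) :
    IsLowerSet (insert x (T.erase y) : Set (Grid r)) ∧ (insert x (T.erase y)).card = T.card ∧
      (lowWeight d (insert x (T.erase y))).card ≤ (lowWeight d T).card ∧
      ∑ z ∈ insert x (T.erase y), rank z < ∑ z ∈ T, rank z := by
  have hxe : x ∉ T.erase y := fun h => hx (Finset.mem_of_mem_erase h)
  refine ⟨?_, ?_, ?_, ?_⟩
  · intro u v hvu hu
    rcases eq_or_ne v u with rfl | hne
    · exact hu
    have hlt := lexLT_of_le_of_ne hvu hne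
    refine Set.mem_insert_of_mem _ (Finset.mem_coe.2 (Finset.mem_erase.2 ?_))
    rcases Set.mem_insert_iff.1 hu with rfl | hu
    · refine ⟨?_, hxmin v hlt⟩
      rintro rfl
      exact lexLT_irrefl _ (hxy.trans hlt)
    · have huT := Finset.mem_of_mem_erase (Finset.mem_coe.1 hu)
      refine ⟨?_, hT hvu huT⟩
      rintro rfl
      exact hymax u huT hlt
  · rw [Finset.card_insert_of_notMem hxe, Finset.card_erase_add_one hy]
  · simp only [lowWeight, Finset.card_filter]
    rw [Finset.sum_insert hxe, ← Finset.add_sum_erase T _ hy]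
    refine Nat.add_le_add_right ?_ _
    split_ifs <;> omega
  · rw [Finset.sum_insert hxe, ← Finset.add_sum_erase T _ hy]
    exact Nat.add_lt_add_right hxy.rank_lt _

theorem lexMinimizes_succ {n : ℕ} {r : Fin (n + 3) → ℕ}
    (ih : ∀ i : Fin (n + 3), LexMinimizes fun j => r (i.succAbove j)) : LexMinimizes r := by
  classical
  intro d T I hT hI hcard
  -- Minimality of the sum of ranks replaces iterated compression and exchange.
  obtain ⟨S, hS, hmin⟩ := Finset.exists_min_image
    (Finset.univ.filter fun S : Finset (Grid r) => IsLowerSet (S : Set (Grid r)) ∧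
      S.card = T.card ∧ (lowWeight d S).card ≤ (lowWeight d T).card)
    (fun S => ∑ x ∈ S, rank x) ⟨T, by simpa using hT⟩
  simp only [Finset.mem_filter, Finset.mem_univ, true_and] at hS hmin
  obtain ⟨hSl, hSc, hSd⟩ := hS
  have hslice : ∀ i a, IsLexInitial (slice S i a) := by
    intro i a
    by_contra h
    refine (hmin (compress S i) ⟨isLowerSet_compress hSl i, (card_compress S i).trans hSc,
      (card_lowWeight_compress_le (ih i) hSl d).trans hSd⟩).not_gt (sum_rank_compress_lt h)
  have hSI : IsLexInitial S := by
    by_contra h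
    obtain ⟨x, y, hx, hy, hxy, hxmin, hymax⟩ := exists_lex_gap h
    have hw := weight_le_of_lex_gap
      (fun i x y hxy hy hi => mem_of_isLexInitial_slice (hslice i) hxy hy hi) hx hy hxy
    obtain ⟨h1, h2, h3, h4⟩ := exchange_lex_gap hSl hx hy hxy hxmin hymax hw d
    exact (hmin _ ⟨by exact_mod_cast h1, h2.trans hSc, h3.trans hSd⟩).not_gt h4
  rw [hI.eq_of_card_eq hSI (hcard.trans hSc.symm)]
  exact hSd

/-! ### Base cases and the induction -/

theorem lexMinimizes_of_le_one {n : ℕ} (hn : n ≤ 1) (r : Fin n → ℕ) : LexMinimizes r := by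
  intro d T I hT hI hcard
  have hTI : IsLexInitial T := by
    rintro x y ⟨i, -, hi⟩ hy
    refine hT (fun j => ?_) hy
    obtain rfl : j = i := Fin.ext (by omega)
    exact hi.le
  rw [hI.eq_of_card_eq hTI hcard]

/-- The points of a two-dimensional grid as pairs of natural numbers. -/
def toPlane {r : Fin 2 → ℕ} (T : Finset (Grid r)) : Finset (ℕ × ℕ) :=
  T.image fun x => ((x 0 : ℕ), (x 1 : ℕ))

theorem toPlane_injective {r : Fin 2 → ℕ} :
    Function.Injective fun x : Grid r => ((x 0 : ℕ), (x 1 : ℕ)) := by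
  intro x y h
  simp only [Prod.mk.injEq] at h
  funext i
  fin_cases i
  · exact Fin.ext h.1
  · exact Fin.ext h.2

theorem card_toPlane {r : Fin 2 → ℕ} (T : Finset (Grid r)) : (toPlane T).card = T.card :=
  Finset.card_image_of_injective _ toPlane_injective

theorem card_filter_toPlane {r : Fin 2 → ℕ} (T : Finset (Grid r)) (d : ℕ) :
    ((toPlane T).filter fun p => p.1 + p.2 ≤ d).card = (lowWeight d T).card := by
  rw [← card_toPlane, toPlane, toPlane, Finset.filter_image, lowWeight]
  simp [weight, Fin.sum_univ_two]

theorem mem_toPlane {r : Fin 2 → ℕ} {T : Finset (Grid r)} {p : ℕ × ℕ} :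
    p ∈ toPlane T ↔ ∃ x ∈ T, (x 0 : ℕ) = p.1 ∧ (x 1 : ℕ) = p.2 := by
  simp [toPlane, Prod.ext_iff]

/-- The point of a two-dimensional grid with the given coordinates. -/
def ofPlane {r : Fin 2 → ℕ} (a b : ℕ) (ha : a < r 0) (hb : b < r 1) : Grid r :=
  Fin.cons (α := fun i => Fin (r i)) ⟨a, ha⟩ fun i => ⟨b, by rwa [Subsingleton.elim i 0]⟩

theorem lexMinimizes_two (r : Fin 2 → ℕ) (hr : Monotone r) : LexMinimizes r := by
  classical
  intro d T I hT hI hcard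
  by_cases huniv : ∀ x, x ∈ I
  · have hIu : I = Finset.univ := Finset.eq_univ_iff_forall.2 huniv
    have : T = Finset.univ := by
      rw [← Finset.card_eq_iff_eq_univ, ← hcard, hIu, Finset.card_univ]
    rw [hIu, this]
  have hnot : ∃ x, x ∉ I := not_forall.1 huniv
  obtain ⟨x, hx, hxmin⟩ : ∃ x, x ∉ I ∧ ∀ z, LexLT z x → z ∈ I := by
    obtain ⟨x₀, hx₀⟩ := hnot
    obtain ⟨x, hx, hxmin⟩ := Finset.exists_min_image Iᶜ rank ⟨x₀, by simpa using hx₀⟩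
    refine ⟨x, by simpa using hx, fun z hz => ?_⟩
    by_contra hzT
    exact (hxmin z (by simpa using hzT)).not_gt hz.rank_lt
  rw [← card_filter_toPlane, ← card_filter_toPlane]
  -- With `x` the first missing point, `I` contains every point with first coordinate below `x 0`
  -- and none with first coordinate above it.
  refine card_filter_add_le_of_isLowerSet (m := r 0) (N := r 1) (q := x 0) (hr (Fin.zero_le 1))
    (x 0).2 ?_ ?_ ?_ ?_ (by rw [card_toPlane, card_toPlane, hcard]) d
  · rintro ⟨a, b⟩ ⟨a', b'⟩ hle hp
    obtain ⟨y, hy, h0, h1⟩ := mem_toPlane.1 (Finset.mem_coe.1 hp)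
    obtain ⟨hle0, hle1⟩ := Prod.mk_le_mk.1 hle
    simp only at h0 h1
    have h0' := (y 0).2
    have h1' := (y 1).2
    refine Finset.mem_coe.2 (mem_toPlane.2
      ⟨ofPlane a' b' (by omega) (by omega), hT (fun i => ?_) hy, rfl, rfl⟩)
    fin_cases i
    · show a' ≤ (y 0 : ℕ)
      omega
    · show b' ≤ (y 1 : ℕ)
      omega
  · intro p hp
    obtain ⟨y, hy, h0, h1⟩ := mem_toPlane.1 hp
    rw [← h0, ← h1]
    exact ⟨(y 0).2, (y 1).2⟩
  · intro p hp
    obtain ⟨y, hy, h0, h1⟩ := mem_toPlane.1 hp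
    rw [← h0, ← h1]
    refine ⟨?_, (y 1).2⟩
    by_contra hcon
    refine lexLT_irrefl x (LexLT.trans ?_ (hI.lexLT hy hx))
    exact ⟨0, fun l hl => absurd hl (Fin.not_lt_zero l), not_le.1 hcon⟩
  · rintro ⟨a, b⟩ ha hb
    refine mem_toPlane.2 ⟨ofPlane a b (ha.trans (x 0).2) hb, hxmin _ ?_, rfl, rfl⟩
    exact ⟨0, fun l hl => absurd hl (Fin.not_lt_zero l), ha⟩

theorem lexMinimizes_of_monotone {n : ℕ} (r : Fin n → ℕ) (hr : Monotone r) : LexMinimizes r := by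
  induction n with
  | zero => exact lexMinimizes_of_le_one (by omega) r
  | succ n ih =>
    match n, ih, r, hr with
    | 0, _, r, _ => exact lexMinimizes_of_le_one le_rfl r
    | 1, _, r, hr => exact lexMinimizes_two r hr
    | n + 2, ih, r, hr =>
      exact lexMinimizes_succ fun i => ih _ (hr.comp (Fin.strictMono_succAbove i).monotone)

end Grid

theorem mainTheorem2 (n : ℕ) (r : Fin n → ℕ) (hr : Monotone r) (d k : ℕ)
    (hk : k ≤ Fintype.card (Grid r)) :
    Grid.minLow r d k = (Grid.lowWeight d (Grid.lexFirst r k)).card ∧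
    IsLowerSet (Grid.lexFirst r k : Set (Grid r)) ∧
    (Grid.lexFirst r k).card = k ∧
    ∀ T : Finset (Grid r), IsLowerSet (T : Set (Grid r)) → T.card = k →
      (Grid.lowWeight d (Grid.lexFirst r k)).card ≤ (Grid.lowWeight d T).card := by
  have hI : Grid.IsLexInitial (Grid.lexFirst r k) := Grid.isLexInitial_lexFirst k
  have hc := Grid.card_lexFirst hk
  have hmin : ∀ T : Finset (Grid r), IsLowerSet (T : Set (Grid r)) → T.card = k →
      (Grid.lowWeight d (Grid.lexFirst r k)).card ≤ (Grid.lowWeight d T).card :=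
    fun T hT hTc => Grid.lexMinimizes_of_monotone r hr d T _ hT hI (hc.trans hTc.symm)
  refine ⟨le_antisymm (Nat.sInf_le ⟨_, hI.isLowerSet, hc, rfl⟩) ?_, hI.isLowerSet, hc, hmin⟩
  -- Nonemptiness is needed, since `sInf` of the empty set would be `0`.
  refine le_csInf ⟨_, _, hI.isLowerSet, hc, rfl⟩ ?_
  rintro m ⟨T, hT, hTc, rfl⟩
  exact hmin T hT hTc
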